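/- **Conventions.** Let $(X,d)$ be a metric space and $\alpha=(\alpha_i)_{i\in\mathbb N}$ a sequence in $X$ with dense range. A function $F:\mathbb N^{k}\to\mathbb Q$ is *computable* if $F(x)=(-1)^{c(x)}\frac{a(x)}{b(x)+1}$ for computable $a,b,c:\mathbb N^k\to\mathbb N$; a function $f:\mathbb N^k\to\mathbb R$ is *computable* if there is a computable $F:\mathbb N^{k+1}\to\mathbb Q$ with $|f(x)-F(x,i)|<2^{-i}$ for all $x\in\mathbb N^k$, $i\in\mathbb N$. The triple $(X,d,\alpha)$ is a *computable metric space* if $(i,j)\mapsto d(\alpha_i,\alpha_j)$ is a computable function $\mathbb N^2\to\mathbb R$. Let $(I_i)_{i\in\mathbb N}$ be a fixed standard computable enumeration of the rational balls, i.e. of the open balls $B(\alpha_k,r)$ with $k\in\mathbb N$ and $r\in\mathbb Q$, $r>0$, and let $(J_j)_{j\in\mathbb N}$ be a fixed standard computable enumeration of the finite nonempty unions of rational balls, $J_j=\bigcup_{i\in[j]}I_i$, where $j\mapsto[j]$ comes from a computable enumeration of all nonempty finite sequences in $\mathbb N$. A closed set $S\subseteq X$ is *computably enumerable (c.e.)*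 if $\{i\in\mathbb N: S\cap I_i\neq\emptyset\}$ is a c.e. subset of $\mathbb N$; it is *co-computably enumerable (co-c.e.)* if $X\setminus S=\bigcup_{i\in A}I_i$ for some c.e. set $A\subseteq\mathbb N$; it is *computable* if it is both c.e. and co-c.e. A compact set $K\subseteq X$ is *computably compact* if $K$ is c.e. and $\{j\in\mathbb N: K\subseteq J_j\}$ is c.e. The space $(X,d,\alpha)$ is *locally computable* if every compact subset of $X$ is contained in a computably compact set. For $n\ge 1$, an *$(n-1)$-sphere* in $X$ is a subset which, with the subspace topology, is homeomorphic to $S^{n-1}=\{x\in\mathbb R^n:\|x\|=1\}$. **Theorem.** Let $(X,d,\alpha)$ be a computable metric space which is locally computable, let $n\ge 1$, and let $S\subseteq X$ be an $(n-1)$-sphere which is co-c.e. in $(X,d,\alpha)$. Then $S$ is computable in $(X,d,\alpha)$. -/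

import Mathlib

namespace CompMetric

/-- A rational-valued function is computable if it is `(-1)^c * a / (b + 1)` for
computable functions `a, b, c` with values in `ℕ`. -/
def ComputableRatFun {β : Type*} [Primcodable β] (F : β → ℚ) : Prop :=
  ∃ a b c : β → ℕ, Computable a ∧ Computable b ∧ Computable c ∧
    ∀ x, F x = (-1) ^ c x * ((a x : ℚ) / ((b x : ℚ) + 1))

/-- A real-valued function is computable if a computable rational-valued function
approximates it with precision `2^(-i)`, uniformly in `i`. -/
def ComputableRealFun {β : Type*} [Primcodable β] (f : β → ℝ) : Prop :=
  ∃ F : β × ℕ → ℚ, ComputableRatFun F ∧ ∀ x i, |f x - (F (x, i) : ℝ)| < ((2 : ℝ) ^ i)⁻¹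

/-- The fixed computable enumeration of the positive rationals: the code of a pair `(a, b)`
is sent to `(a + 1) / (b + 1)`. -/
def posRat (i : ℕ) : ℚ := ((i.unpair.1 : ℚ) + 1) / ((i.unpair.2 : ℚ) + 1)

/-- The fixed computable enumeration of all nonempty finite sequences in `ℕ`: the code of a
pair gives the first entry and the code of the list of the remaining entries. -/
def finSeq (j : ℕ) : List ℕ := j.unpair.1 :: Denumerable.ofNat (List ℕ) j.unpair.2

section

variable {X : Type*} [MetricSpace X]

/-- `(X, d, α)` is a computable metric space. -/
structure IsComputableMetricSpace (α : ℕ → X) : Prop where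
  dense : DenseRange α
  computable_dist : ComputableRealFun fun p : ℕ × ℕ => dist (α p.1) (α p.2)

/-- The `i`-th rational open ball `I_i`. -/
def ratBall (α : ℕ → X) (i : ℕ) : Set X :=
  Metric.ball (α i.unpair.1) (posRat i.unpair.2 : ℝ)

/-- The `j`-th finite union `J_j` of rational open balls. -/
def ratUnion (α : ℕ → X) (j : ℕ) : Set X := ⋃ i ∈ finSeq j, ratBall α i

/-- `S` is a computably enumerable closed set. -/
def IsCE (α : ℕ → X) (S : Set X) : Prop :=
  IsClosed S ∧ REPred fun i : ℕ => (S ∩ ratBall α i).Nonempty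

/-- `S` is a co-computably enumerable closed set: its complement is the union of a c.e. family
of rational balls. The family may be empty, so that the whole space is co-c.e.; a nonempty
c.e. family is the same as a family `I_{f(0)}, I_{f(1)}, …` with `f` computable. -/
def IsCoCE (α : ℕ → X) (S : Set X) : Prop :=
  IsClosed S ∧ ∃ A : Set ℕ, (REPred fun i : ℕ => i ∈ A) ∧ Sᶜ = ⋃ i ∈ A, ratBall α i

/-- `S` is a computable set: both c.e. and co-c.e. -/
def IsComputableSet (α : ℕ → X) (S : Set X) : Prop := IsCE α S ∧ IsCoCE α S

/-- `K` is computably compact. -/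
def IsComputablyCompact (α : ℕ → X) (K : Set X) : Prop :=
  IsCompact K ∧ IsCE α K ∧ REPred fun j : ℕ => K ⊆ ratUnion α j

/-- `(X, d, α)` is locally computable: every compact set lies in a computably compact set. -/
def IsLocallyComputable (α : ℕ → X) : Prop :=
  ∀ A : Set X, IsCompact A → ∃ K : Set X, IsComputablyCompact α K ∧ A ⊆ K

/-- `S` is an `m`-sphere: with the subspace topology it is homeomorphic to the Euclidean unit
sphere of `ℝ^(m+1)`. -/
def IsTopSphere (m : ℕ) (S : Set X) : Prop :=
  Nonempty (Metric.sphere (0 : EuclideanSpace ℝ (Fin (m + 1))) 1 ≃ₜ S)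

end

end CompMetric

/-! Since `S` is compact and co-c.e., it lies in a computably compact set, and coverings of `S` by
finitely many rational balls can be enumerated (`re_subset_ratUnion_of_isCoCE`). What remains is to
turn "this ball meets `S`" into a statement about coverings; dimension theory of the cube does this.

Take a chart of `S` by `ℝ^m` with the sup norm, so that balls are cubes. Fix finitely many rational
balls `W` covering the part of `S` outside the cube of radius 2 and missing the cube of radius 1,
and tagged balls `O` covering the faces of the latter. A ball `I_i` is accepted when some further
tagged balls `M` are found such that oppositely tagged balls of `M ++ O` are formally disjoint and
`I_i`, `W`, `M`, `O` together cover `S`. Both conditions are c.e.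

Soundness (`IsCertified.nonempty`): by Poincaré–Miranda the tagged balls cannot cover the cube of
radius 1, and `W` misses it, so `I_i` must contain a point of it. Completeness
(`exists_re_local_certificate`): if `I_i` contains a small cube around a point near the chart's
centre, the slabs on either side of that cube in each axis direction are disjoint compact sets, and
fine covers of them give `M`. By compactness finitely many charts suffice; their data are not
computed, only finite.

Poincaré–Miranda itself follows from a lattice lemma, proved by a cup product of coboundaries modulo
2 and a discrete Stokes formula. -/

namespace CompMetric

/-! ### Cup products on the lattice modulo 2, and the Poincaré–Miranda theorem. -/

section Grid

variable {ι : Type*} [DecidableEq ι]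

/-- The neighbour of the lattice point `x` in the positive direction `j`. -/
def latticeStep (j : ι) (x : ι → ℕ) : ι → ℕ := Function.update x j (x j + 1)

theorem latticeStep_comm (j k : ι) (x : ι → ℕ) :
    latticeStep j (latticeStep k x) = latticeStep k (latticeStep j x) := by
  funext a
  by_cases hj : a = j <;> by_cases hk : a = k <;> subst_vars <;>
    simp_all [latticeStep, Function.update_apply]

/-- The sum, over all monotone lattice paths from `x` which use every direction in `s` at most
once, of the products of the increments of the functions `f i`, `i ∈ l`, along the path. This is
the cup product of the coboundaries of the `f i`, evaluated on a triangulated cube. -/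
def pathSum (f : ι → (ι → ℕ) → ZMod 2) : List ι → Finset ι → (ι → ℕ) → ZMod 2
  | [], _, _ => 1
  | i :: l, s, x => ∑ j ∈ s, (f i (latticeStep j x) - f i x) *
      pathSum f l (s.erase j) (latticeStep j x)

/-- Swapping `j` and `k` pairs off equal terms, which cancel in characteristic 2; this is the `d² =
0` of the argument. -/
theorem sum_erase_eq_zero_of_symm (s : Finset ι) (h : ι → ι → ZMod 2)
    (hs : ∀ j k, h j k = h k j) : ∑ j ∈ s, ∑ k ∈ s.erase j, h j k = 0 := by
  rw [Finset.sum_sigma']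
  refine Finset.sum_involution (fun p _ => ⟨p.2, p.1⟩) ?_ ?_ ?_ ?_
  · rintro ⟨j, k⟩ _
    simp only [hs k j]
    exact CharTwo.add_self_eq_zero _
  · rintro ⟨j, k⟩ hp _ he
    simp only [Finset.mem_sigma, Finset.mem_erase] at hp
    simp only [Sigma.mk.injEq] at he
    exact hp.2.1 he.1
  · rintro ⟨j, k⟩ hp
    simp only [Finset.mem_sigma, Finset.mem_erase] at hp ⊢
    exact ⟨hp.2.2, hp.2.1.symm, hp.1⟩
  · rintro ⟨j, k⟩ _
    rfl

/-- Leibniz rule: closedness of the shorter cochain allows its value at the shifted points to be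
replaced by its value at `x` in the terms multiplied by `f i x`. -/
theorem pathSum_cons_of_closed (f : ι → (ι → ℕ) → ZMod 2) (i : ι) (l : List ι)
    (hl : ∀ (s : Finset ι) (x : ι → ℕ), ∑ j ∈ s, (pathSum f l (s.erase j) (latticeStep j x) -
      pathSum f l (s.erase j) x) = 0) (s : Finset ι) (x : ι → ℕ) :
    pathSum f (i :: l) s x = ∑ j ∈ s,
      (f i (latticeStep j x) * pathSum f l (s.erase j) (latticeStep j x) -
        f i x * pathSum f l (s.erase j) x) := by
  have h := hl s x
  rw [Finset.sum_sub_distrib, sub_eq_zero] at h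
  simp only [pathSum, sub_mul, Finset.sum_sub_distrib, ← Finset.mul_sum, h]

/-- Inductively the longer cochain is a coboundary, so its own coboundary is a double difference
symmetric in the two directions. -/
theorem pathSum_closed (f : ι → (ι → ℕ) → ZMod 2) (l : List ι) :
    ∀ (s : Finset ι) (x : ι → ℕ), ∑ j ∈ s, (pathSum f l (s.erase j) (latticeStep j x) -
      pathSum f l (s.erase j) x) = 0 := by
  induction l with
  | nil => intro s x; simp [pathSum]
  | cons i l ih =>
    intro s x
    simp only [pathSum_cons_of_closed f i l ih, ← Finset.sum_sub_distrib]
    apply sum_erase_eq_zero_of_symm s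
    intro j k
    rw [Finset.erase_right_comm, latticeStep_comm k j]
    ring

/-- The discrete Stokes formula. -/
theorem pathSum_cons (f : ι → (ι → ℕ) → ZMod 2) (i : ι) (l : List ι) (s : Finset ι) (x : ι → ℕ) :
    pathSum f (i :: l) s x = ∑ j ∈ s,
      (f i (latticeStep j x) * pathSum f l (s.erase j) (latticeStep j x) -
        f i x * pathSum f l (s.erase j) x) :=
  pathSum_cons_of_closed f i l (pathSum_closed f l) s x

/-- The paths never leave the hyperplane `x j = v`, so the factor that is an increment of `f j`
vanishes. -/
theorem pathSum_eq_zero_of_const (f : ι → (ι → ℕ) → ZMod 2) {j : ι} {v : ℕ} {b : ZMod 2}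
    (hf : ∀ y : ι → ℕ, y j = v → f j y = b) {l : List ι} (hj : j ∈ l) :
    ∀ {s : Finset ι} {x : ι → ℕ}, j ∉ s → x j = v → pathSum f l s x = 0 := by
  induction l with
  | nil => simp at hj
  | cons i l ih =>
    intro s x hs hx
    refine Finset.sum_eq_zero fun k hk => ?_
    have hkj : j ≠ k := fun h => hs (h ▸ hk)
    have hx' : latticeStep k x j = v := by simp [latticeStep, hkj, hx]
    rcases eq_or_ne j i with rfl | hij
    · rw [hf _ hx, hf _ hx', sub_self, zero_mul]
    · rw [ih (by simpa [hij] using hj) (fun h => hs (Finset.mem_of_mem_erase h)) hx', mul_zero]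

theorem exists_ne_of_pathSum_ne_zero (f : ι → (ι → ℕ) → ZMod 2) {l : List ι} {i : ι}
    (hi : i ∈ l) : ∀ {s : Finset ι} {x : ι → ℕ}, pathSum f l s x ≠ 0 →
      ∃ y z : ι → ℕ, (∀ k, x k ≤ y k ∧ y k ≤ x k + if k ∈ s then 1 else 0) ∧
        (∀ k, x k ≤ z k ∧ z k ≤ x k + if k ∈ s then 1 else 0) ∧ f i y ≠ f i z := by
  induction l with
  | nil => simp at hi
  | cons a l ih =>
    intro s x h
    obtain ⟨j, hj, hne⟩ := Finset.exists_ne_zero_of_sum_ne_zero h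
    have hstep : ∀ k, x k ≤ latticeStep j x k ∧
        latticeStep j x k + (if k ∈ s.erase j then 1 else 0) ≤ x k + if k ∈ s then 1 else 0 := by
      intro k
      by_cases hk : k = j
      · subst hk; simp [latticeStep, hj]
      · simp [latticeStep, hk]
    rcases eq_or_ne i a with rfl | hia
    · exact ⟨latticeStep j x, x, fun k => ⟨(hstep k).1, (Nat.le_add_right _ _).trans (hstep k).2⟩,
        fun k => ⟨le_rfl, Nat.le_add_right _ _⟩, sub_ne_zero.1 (left_ne_zero_of_mul hne)⟩
    · obtain ⟨y, z, hy, hz, hyz⟩ := ih (by simpa [hia] using hi) (right_ne_zero_of_mul hne)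
      exact ⟨y, z, fun k => ⟨(hstep k).1.trans (hy k).1, (hy k).2.trans (hstep k).2⟩,
        fun k => ⟨(hstep k).1.trans (hz k).1, (hz k).2.trans (hstep k).2⟩, hyz⟩

/-- The sum of `F` over the box of points whose coordinates in `l` range over `0, …, N - 1` and
whose other coordinates are those of `c`. -/
def boxSum (N : ℕ) : List ι → ((ι → ℕ) → ZMod 2) → (ι → ℕ) → ZMod 2
  | [], F, c => F c
  | j :: l, F, c => ∑ t ∈ Finset.range N, boxSum N l F (Function.update c j t)

theorem boxSum_perm (N : ℕ) (F : (ι → ℕ) → ZMod 2) {l l' : List ι} (h : l.Perm l') :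
    ∀ c, boxSum N l F c = boxSum N l' F c := by
  induction h with
  | nil => intro c; rfl
  | cons j _ ih => intro c; simp only [boxSum, ih]
  | swap j k l =>
    intro c
    rcases eq_or_ne j k with rfl | hjk
    · rfl
    · simp only [boxSum]
      rw [Finset.sum_comm]
      simp only [Function.update_comm hjk]
  | trans _ _ ih₁ ih₂ => intro c; rw [ih₁, ih₂]

theorem boxSum_sum (N : ℕ) (l : List ι) {κ : Type*} (s : Finset κ) (F : κ → (ι → ℕ) → ZMod 2) :
    ∀ c, boxSum N l (fun x => ∑ j ∈ s, F j x) c = ∑ j ∈ s, boxSum N l (F j) c := by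
  induction l with
  | nil => intro c; rfl
  | cons i l ih => intro c; simp only [boxSum, ih]; exact Finset.sum_comm

theorem boxSum_sub (N : ℕ) (l : List ι) (F G : (ι → ℕ) → ZMod 2) :
    ∀ c, boxSum N l (fun x => F x - G x) c = boxSum N l F c - boxSum N l G c := by
  induction l with
  | nil => intro c; rfl
  | cons i l ih => intro c; simp only [boxSum, ih, Finset.sum_sub_distrib]

theorem boxSum_congr (N : ℕ) {F G : (ι → ℕ) → ZMod 2} {j : ι} {v : ℕ} {l : List ι} (hj : j ∉ l)
    (h : ∀ x : ι → ℕ, x j = v → F x = G x) : ∀ {c}, c j = v → boxSum N l F c = boxSum N l G c := by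
  induction l with
  | nil => intro c hc; exact h c hc
  | cons i l ih =>
    intro c hc
    rw [List.mem_cons, not_or] at hj
    exact Finset.sum_congr rfl fun t _ => ih hj.2 (by simp [hj.1, hc])

theorem boxSum_zero (N : ℕ) (l : List ι) : ∀ c, boxSum N l (fun _ => 0) c = 0 := by
  induction l with
  | nil => intro c; rfl
  | cons i l ih => intro c; simp [boxSum, ih]

theorem boxSum_latticeStep (N : ℕ) (g : (ι → ℕ) → ZMod 2) {j : ι} {l : List ι} (hj : j ∉ l) :
    ∀ c, boxSum N l (fun x => g (latticeStep j x)) c = boxSum N l g (latticeStep j c) := by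
  induction l with
  | nil => intro c; rfl
  | cons i l ih =>
    intro c
    rw [List.mem_cons, not_or] at hj
    refine Finset.sum_congr rfl fun t _ => ?_
    rw [ih hj.2]
    congr 1
    simp only [latticeStep, Function.update_of_ne hj.1]
    rw [Function.update_comm hj.1]

theorem boxSum_telescope (N : ℕ) (g : (ι → ℕ) → ZMod 2) {j : ι} {l : List ι} (hj : j ∉ l)
    (c : ι → ℕ) : boxSum N (j :: l) (fun x => g (latticeStep j x) - g x) c =
      boxSum N l g (Function.update c j N) - boxSum N l g (Function.update c j 0) := by
  simp only [boxSum, boxSum_sub, boxSum_latticeStep N g hj]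
  rw [← Finset.sum_range_sub (fun t => boxSum N l g (Function.update c j t))]
  simp [latticeStep]

/-- By Stokes the sum reduces to the faces of the box. Faces orthogonal to `j ≠ i` contribute
nothing because `f j` is constant there; `f i` kills the face `x i = 0` and is `1` on `x i = N`,
leaving the same sum in one dimension less. -/
theorem boxSum_pathSum (N : ℕ) (f : ι → (ι → ℕ) → ZMod 2) (h0 : ∀ i x, x i = 0 → f i x = 0)
    (h1 : ∀ i x, x i = N → f i x = 1) (l : List ι) (hl : l.Nodup) :
    ∀ c, boxSum N l (pathSum f l l.toFinset) c = 1 := by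
  induction l with
  | nil => intro c; rfl
  | cons i l ih =>
    intro c
    obtain ⟨hi, hl'⟩ := List.nodup_cons.1 hl
    have hfun : pathSum f (i :: l) (i :: l).toFinset = fun x => ∑ j ∈ (i :: l).toFinset,
        (f i (latticeStep j x) * pathSum f l ((i :: l).toFinset.erase j) (latticeStep j x) -
          f i x * pathSum f l ((i :: l).toFinset.erase j) x) :=
      funext fun x => pathSum_cons f i l _ x
    rw [hfun, boxSum_sum]
    have hterm : ∀ j ∈ (i :: l).toFinset, boxSum N (i :: l) (fun x =>
        f i (latticeStep j x) * pathSum f l ((i :: l).toFinset.erase j) (latticeStep j x) -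
          f i x * pathSum f l ((i :: l).toFinset.erase j) x) c =
        boxSum N ((i :: l).erase j) (fun x => f i x * pathSum f l ((i :: l).toFinset.erase j) x)
          (Function.update c j N) -
        boxSum N ((i :: l).erase j) (fun x => f i x * pathSum f l ((i :: l).toFinset.erase j) x)
          (Function.update c j 0) := by
      intro j hj
      rw [boxSum_perm N _ (List.perm_cons_erase (List.mem_toFinset.1 hj)) c]
      exact boxSum_telescope N
        (fun x => f i x * pathSum f l ((i :: l).toFinset.erase j) x) (hl.not_mem_erase) c
    rw [Finset.sum_congr rfl hterm, Finset.sum_eq_single i]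
    · have he : (i :: l).toFinset.erase i = l.toFinset := by simp [hi]
      rw [he, List.erase_cons_head]
      rw [boxSum_congr N (G := pathSum f l l.toFinset) (v := N)
          (c := Function.update c i N) hi
          (fun x hx => by rw [h1 i x hx, one_mul]) (by simp),
        boxSum_congr N (G := fun _ => 0) (v := 0) (c := Function.update c i 0) hi
          (fun x hx => by rw [h0 i x hx, zero_mul]) (by simp), boxSum_zero, ih hl', sub_zero]
    · intro j hj hji
      have hjl : j ∈ l := by simpa [hji] using hj
      rw [boxSum_congr N (G := fun _ => 0) (v := N) (c := Function.update c j N) hl.not_mem_erase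
          (fun x hx => by
            rw [pathSum_eq_zero_of_const f (h1 j) hjl (Finset.notMem_erase _ _) hx, mul_zero])
          (by simp),
        boxSum_congr N (G := fun _ => 0) (v := 0) (c := Function.update c j 0) hl.not_mem_erase
          (fun x hx => by
            rw [pathSum_eq_zero_of_const f (h0 j) hjl (Finset.notMem_erase _ _) hx, mul_zero])
          (by simp), boxSum_zero, boxSum_zero, sub_zero]
    · simp

theorem exists_ne_zero_of_boxSum_ne_zero (N : ℕ) (F : (ι → ℕ) → ZMod 2) (l : List ι) (c : ι → ℕ)
    (h : boxSum N l F c ≠ 0) : ∃ x, F x ≠ 0 := by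
  by_contra! hF
  exact h (by rw [show F = fun _ => 0 from funext hF, boxSum_zero])

/-- Kuhn's combinatorial lemma: if `f i` is `0` where the `i`-th coordinate vanishes and `1` where
it is `N`, then some unit cube carries both values of every `f i`. -/
theorem exists_unit_cube_two_valued [Fintype ι] (N : ℕ) (f : ι → (ι → ℕ) → ZMod 2)
    (h0 : ∀ i x, x i = 0 → f i x = 0) (h1 : ∀ i x, x i = N → f i x = 1) :
    ∃ x : ι → ℕ, ∀ i, ∃ y z : ι → ℕ, (∀ k, x k ≤ y k ∧ y k ≤ x k + 1) ∧
      (∀ k, x k ≤ z k ∧ z k ≤ x k + 1) ∧ f i y ≠ f i z := by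
  have hne := boxSum_pathSum N f h0 h1 _ (Finset.univ : Finset ι).nodup_toList 0
  obtain ⟨x, hx⟩ := exists_ne_zero_of_boxSum_ne_zero N _ _ _ (hne.trans_ne one_ne_zero)
  refine ⟨x, fun i => ?_⟩
  obtain ⟨y, z, hy, hz, hyz⟩ := exists_ne_of_pathSum_ne_zero f (i := i) (by simp) hx
  simp only [Finset.toList_toFinset, Finset.mem_univ, if_true] at hy hz
  exact ⟨y, z, hy, hz, hyz⟩

end Grid

/-- The covering form of the **Poincaré–Miranda theorem**: if disjoint open sets `U i`, `V i`
contain the two faces of the cube orthogonal to the `i`-th axis, then the union of all of them is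
not the whole cube. -/
theorem exists_mem_cube_notMem {ι : Type*} [Fintype ι] (U V : ι → Set (ι → ℝ))
    (hUo : ∀ i, IsOpen (U i)) (hVo : ∀ i, IsOpen (V i)) (hUV : ∀ i, Disjoint (U i) (V i))
    (hU : ∀ i, ∀ x ∈ Set.Icc (-1 : ι → ℝ) 1, x i = 1 → x ∈ U i)
    (hV : ∀ i, ∀ x ∈ Set.Icc (-1 : ι → ℝ) 1, x i = -1 → x ∈ V i) :
    ∃ x ∈ Set.Icc (-1 : ι → ℝ) 1, ∀ i, x ∉ U i ∧ x ∉ V i := by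
  classical
  by_contra! hcov
  obtain ⟨δ, hδ, hleb⟩ := lebesgue_number_lemma_of_metric (s := Set.Icc (-1 : ι → ℝ) 1)
    (c := fun t : ι × Bool => if t.2 then U t.1 else V t.1) isCompact_Icc
    (by rintro ⟨i, _ | _⟩ <;> simp [hUo, hVo])
    (by
      intro x hx
      obtain ⟨i, hi⟩ := hcov x hx
      rw [Set.mem_iUnion]
      by_cases hxU : x ∈ U i
      · exact ⟨(i, true), by simpa using hxU⟩
      · exact ⟨(i, false), by simpa using hi hxU⟩)
  obtain ⟨N, hN⟩ := exists_nat_gt (2 / δ)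
  have hN0 : (0 : ℝ) < N := (by positivity : (0 : ℝ) < 2 / δ).trans hN
  have hNδ : 2 / (N : ℝ) < δ := by
    rw [div_lt_iff₀ hδ] at hN
    rw [div_lt_iff₀ hN0]
    linarith
  -- The truncation keeps `P x` in the cube for every lattice point, since the combinatorial lemma
  -- does not bound the coordinates.
  let P : (ι → ℕ) → ι → ℝ := fun x i => -1 + 2 * min ((x i : ℝ) / N) 1
  have hP : ∀ x, P x ∈ Set.Icc (-1 : ι → ℝ) 1 := by
    intro x
    constructor <;> intro i
    · have : 0 ≤ min ((x i : ℝ) / N) 1 := by positivity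
      simp only [P, Pi.neg_apply, Pi.one_apply]; linarith
    · have : min ((x i : ℝ) / N) 1 ≤ 1 := min_le_right _ _
      simp only [P, Pi.one_apply]; linarith
  let f : ι → (ι → ℕ) → ZMod 2 := fun i x => if P x ∈ U i then 1 else 0
  obtain ⟨x, hx⟩ := exists_unit_cube_two_valued N f
    (by
      intro i x hxi
      have : P x ∈ V i := hV i _ (hP x) (by simp [P, hxi])
      exact if_neg fun h => (hUV i).le_bot ⟨h, this⟩)
    (by
      intro i x hxi
      exact if_pos (hU i _ (hP x) (by simp [P, hxi, hN0.ne']; norm_num)))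
  obtain ⟨⟨i, b⟩, hb⟩ := hleb (P x) (hP x)
  have hball : ∀ y : ι → ℕ, (∀ k, x k ≤ y k ∧ y k ≤ x k + 1) → P y ∈ Metric.ball (P x) δ := by
    intro y hy
    refine lt_of_le_of_lt ((dist_pi_le_iff (by positivity)).2 fun k => ?_) hNδ
    have h1 : (x k : ℝ) ≤ y k := by exact_mod_cast (hy k).1
    have h2 : (y k : ℝ) ≤ x k + 1 := by exact_mod_cast (hy k).2
    have h3 : |min ((y k : ℝ) / N) 1 - min ((x k : ℝ) / N) 1| ≤ 1 / N := by
      refine (abs_min_sub_min_le_max _ _ _ _).trans ?_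
      rw [sub_self, abs_zero, max_eq_left (abs_nonneg _), ← sub_div,
        abs_of_nonneg (div_nonneg (by linarith) hN0.le)]
      gcongr
      linarith
    rw [Real.dist_eq]
    calc |P y k - P x k| = 2 * |min ((y k : ℝ) / N) 1 - min ((x k : ℝ) / N) 1| := by
          rw [show P y k - P x k = 2 * (min ((y k : ℝ) / N) 1 - min ((x k : ℝ) / N) 1) by
            simp only [P]; ring, abs_mul, abs_of_pos (by norm_num : (0 : ℝ) < 2)]
      _ ≤ 2 * (1 / N) := by gcongr
      _ = 2 / N := by ring
  obtain ⟨y, z, hy, hz, hyz⟩ := hx i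
  have hy' := hb (hball y hy)
  have hz' := hb (hball z hz)
  cases b with
  | true =>
    simp only [if_true] at hy' hz'
    exact hyz (by simp only [f, if_pos hy', if_pos hz'])
  | false =>
    simp only [Bool.false_eq_true, if_false] at hy' hz'
    exact hyz (by simp only [f, if_neg fun h => (hUV i).le_bot ⟨h, hy'⟩,
      if_neg fun h => (hUV i).le_bot ⟨h, hz'⟩])

/-! ### Closure properties of c.e. predicates. -/

section RE

variable {β γ : Type*} [Primcodable β] [Primcodable γ]

theorem _root_.REPred.comp {p : γ → Prop} (hp : REPred p) {f : β → γ} (hf : Computable f) :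
    REPred fun a => p (f a) :=
  Partrec.comp hp hf

theorem _root_.ComputablePred.exists_nat {q : β × ℕ → Prop} (hq : ComputablePred q) :
    REPred fun a => ∃ n, q (a, n) := by
  obtain ⟨_, hq⟩ := hq
  have h : Partrec fun a : β => Nat.rfind fun n => (Part.some (decide (q (a, n)))) :=
    Partrec.rfind (p := fun a n => Part.some (decide (q (a, n)))) hq.partrec
  refine h.dom_re.of_eq fun a => ?_
  refine Nat.rfind_dom.trans ?_
  simp

/-- Stages of the enumeration of a c.e. predicate. -/
theorem _root_.REPred.exists_primrec {p : β → Prop} (hp : REPred p) :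
    ∃ q : β → ℕ → Prop, PrimrecRel q ∧ (∀ a m n, m ≤ n → q a m → q a n) ∧
      ∀ a, p a ↔ ∃ n, q a n := by
  obtain ⟨c, hc⟩ := Nat.Partrec.Code.exists_code.1 hp
  refine ⟨fun a n => (Nat.Partrec.Code.evaln n c (Encodable.encode a)).isSome = true, ?_, ?_, ?_⟩
  · refine ⟨fun _ => inferInstance, ?_⟩
    have : Primrec fun x : β × ℕ =>
        (Nat.Partrec.Code.evaln x.2 c (Encodable.encode x.1)).isSome :=
      Primrec.option_isSome.comp (Nat.Partrec.Code.primrec_evaln.comp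
        (((Primrec.snd).pair (Primrec.const c)).pair (Primrec.encode.comp Primrec.fst)))
    exact this.of_eq fun x => by simp
  · intro a m n hmn h
    obtain ⟨x, hx⟩ := Option.isSome_iff_exists.1 h
    exact Option.isSome_iff_exists.2 ⟨x, Nat.Partrec.Code.evaln_mono hmn hx⟩
  · intro a
    have h1 : p a ↔ (Nat.Partrec.Code.eval c (Encodable.encode a)).Dom := by
      rw [hc]
      simp [Part.assert]
    rw [h1, Part.dom_iff_mem]
    constructor
    · rintro ⟨y, hy⟩
      obtain ⟨k, hk⟩ := Nat.Partrec.Code.evaln_complete.1 hy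
      exact ⟨k, Option.isSome_iff_exists.2 ⟨y, hk⟩⟩
    · rintro ⟨k, hk⟩
      obtain ⟨y, hy⟩ := Option.isSome_iff_exists.1 hk
      exact ⟨y, Nat.Partrec.Code.evaln_sound hy⟩

theorem _root_.PrimrecRel.exists_nat {q : β → ℕ → Prop} (hq : PrimrecRel q) :
    REPred fun a => ∃ n, q a n :=
  ComputablePred.exists_nat (q := fun x => q x.1 x.2) (PrimrecPred.computablePred (p := fun x : β × ℕ => q x.1 x.2) hq)

theorem _root_.REPred.exists {p : β × γ → Prop} (hp : REPred p) :
    REPred fun a => ∃ c, p (a, c) := by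
  classical
  obtain ⟨q, hq, -, hpq⟩ := hp.exists_primrec
  -- Dovetailing: one number encodes both a witness and a stage of the enumeration.
  let g : β × ℕ → Bool := fun x =>
    Option.casesOn (Encodable.decode x.2.unpair.1 : Option γ) false
      fun c => decide (q (x.1, c) x.2.unpair.2)
  have hun : Primrec fun x : β × ℕ => x.2.unpair := Primrec.unpair.comp Primrec.snd
  have hg : Primrec g := by
    refine Primrec.option_casesOn (Primrec.decode.comp (Primrec.fst.comp hun))
      (Primrec.const false) ?_
    exact (PrimrecPred.decide hq).comp (((Primrec.fst.comp Primrec.fst).pair Primrec.snd).pair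
      (Primrec.snd.comp (hun.comp Primrec.fst)))
  have hre : REPred fun a => ∃ n, g (a, n) = true :=
    ComputablePred.exists_nat (q := fun x => g x = true)
      (ComputablePred.computable_iff.2 ⟨g, hg.to_comp, rfl⟩)
  refine hre.of_eq fun a => ?_
  constructor
  · rintro ⟨n, hn⟩
    simp only [g] at hn
    cases hd : (Encodable.decode n.unpair.1 : Option γ) with
    | none => simp [hd] at hn
    | some c =>
      rw [hd] at hn
      exact ⟨c, (hpq _).2 ⟨_, of_decide_eq_true hn⟩⟩
  · rintro ⟨c, hc⟩
    obtain ⟨n, hn⟩ := (hpq _).1 hc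
    exact ⟨Nat.pair (Encodable.encode c) n, by simpa [g] using hn⟩

theorem _root_.REPred.and {p q : β → Prop} (hp : REPred p) (hq : REPred q) :
    REPred fun a => p a ∧ q a := by
  obtain ⟨p', hp', hpm, hpp⟩ := hp.exists_primrec
  obtain ⟨q', hq', hqm, hqq⟩ := hq.exists_primrec
  refine (PrimrecRel.exists_nat (q := fun a n => p' a n ∧ q' a n)
    (PrimrecPred.and hp' hq')).of_eq fun a => ?_
  rw [hpp, hqq]
  constructor
  · rintro ⟨n, h1, h2⟩
    exact ⟨⟨n, h1⟩, ⟨n, h2⟩⟩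
  · rintro ⟨⟨n, h1⟩, ⟨k, h2⟩⟩
    exact ⟨max n k, hpm _ _ _ (le_max_left _ _) h1, hqm _ _ _ (le_max_right _ _) h2⟩

theorem _root_.REPred.or {p q : β → Prop} (hp : REPred p) (hq : REPred q) :
    REPred fun a => p a ∨ q a := by
  obtain ⟨p', hp', -, hpp⟩ := hp.exists_primrec
  obtain ⟨q', hq', -, hqq⟩ := hq.exists_primrec
  refine (PrimrecRel.exists_nat (q := fun a n => p' a n ∨ q' a n)
    (PrimrecPred.or hp' hq')).of_eq fun a => ?_
  rw [hpp, hqq, exists_or]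

theorem _root_.REPred.exists_mem_finset {κ : Type*} (s : Finset κ) {p : κ → β → Prop}
    (hp : ∀ k, REPred (p k)) : REPred fun a => ∃ k ∈ s, p k a := by
  classical
  induction s using Finset.induction_on with
  | empty =>
    refine (ComputablePred.to_re (p := fun _ : β => False) ?_).of_eq fun a => by simp
    exact ⟨fun _ => inferInstance, (Computable.const false).of_eq fun _ => by simp⟩
  | insert k s _ ih => exact ((hp k).or ih).of_eq fun a => by simp

/-- Monotonicity of the stages lets finitely many conditions share a single stage, the maximum. -/
theorem _root_.REPred.forall_mem_list {p : γ × β → Prop} (hp : REPred p) :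
    REPred fun x : List γ × β => ∀ c ∈ x.1, p (c, x.2) := by
  obtain ⟨q, hq, hm, hpq⟩ := hp.exists_primrec
  have hq' : PrimrecRel fun (c : γ) (y : β × ℕ) => q (c, y.1) y.2 :=
    PrimrecRel.comp hq (Primrec.fst.pair (Primrec.fst.comp Primrec.snd))
      (Primrec.snd.comp Primrec.snd)
  have hr : PrimrecRel fun (x : List γ × β) (n : ℕ) => ∀ c ∈ x.1, q (c, x.2) n :=
    PrimrecRel.comp hq'.forall_mem_list (Primrec.fst.comp Primrec.fst)
      ((Primrec.snd.comp Primrec.fst).pair Primrec.snd)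
  refine hr.exists_nat.of_eq ?_
  rintro ⟨l, b⟩
  simp only
  induction l with
  | nil => simp
  | cons c l ih =>
    simp only [List.forall_mem_cons, hpq (c, b), ← ih]
    constructor
    · rintro ⟨n, h1, h2⟩
      exact ⟨⟨n, h1⟩, ⟨n, h2⟩⟩
    · rintro ⟨⟨n, h1⟩, ⟨k, h2⟩⟩
      exact ⟨max n k, hm _ _ _ (le_max_left _ _) h1,
        fun d hd => hm _ _ _ (le_max_right _ _) (h2 d hd)⟩

end RE

/-! ### Formal disjointness of rational balls is c.e. -/

section FormallyDisjoint

variable {X : Type*} [MetricSpace X]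

/-- The rational balls with indices `i` and `j` are formally disjoint: the distance between the
centres exceeds the sum of the radii. -/
def FormallyDisjoint (α : ℕ → X) (i j : ℕ) : Prop :=
  (posRat i.unpair.2 : ℝ) + posRat j.unpair.2 < dist (α i.unpair.1) (α j.unpair.1)

theorem FormallyDisjoint.disjoint {α : ℕ → X} {i j : ℕ} (h : FormallyDisjoint α i j) :
    Disjoint (ratBall α i) (ratBall α j) :=
  Metric.ball_disjoint_ball h.le

/-- Clearing denominators makes the comparison a decidable one between natural numbers; for odd `c`
the right side is nonpositive and the inequality fails. -/
theorem lt_signed_frac_iff (a b c n r₁ r₂ s₁ s₂ : ℕ) :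
    ((r₁ : ℚ) + 1) / (r₂ + 1) + ((s₁ : ℚ) + 1) / (s₂ + 1) + (2 ^ n)⁻¹ <
        (-1) ^ c * ((a : ℚ) / (b + 1)) ↔
      c % 2 = 0 ∧
        (2 ^ n * ((r₁ + 1) * (s₂ + 1) + (s₁ + 1) * (r₂ + 1)) + (r₂ + 1) * (s₂ + 1)) * (b + 1) <
          a * (2 ^ n * ((r₂ + 1) * (s₂ + 1))) := by
  have hL : ((r₁ : ℚ) + 1) / (r₂ + 1) + ((s₁ : ℚ) + 1) / (s₂ + 1) + (2 ^ n)⁻¹ =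
      (2 ^ n * ((r₁ + 1) * (s₂ + 1) + (s₁ + 1) * (r₂ + 1)) + (r₂ + 1) * (s₂ + 1)) /
        (2 ^ n * ((r₂ + 1) * (s₂ + 1))) := by
    field_simp
  rcases Nat.even_or_odd c with hc | hc
  · rw [hc.neg_one_pow, one_mul, hL, div_lt_div_iff₀ (by positivity) (by positivity)]
    simp only [Nat.even_iff.1 hc, true_and]
    exact_mod_cast Iff.rfl
  · rw [hc.neg_one_pow]
    simp only [Nat.odd_iff.1 hc, one_ne_zero, false_and, iff_false, not_lt]
    have h1 : (0 : ℚ) ≤ (a : ℚ) / (b + 1) := by positivity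
    have h2 : (0 : ℚ) ≤ ((r₁ : ℚ) + 1) / (r₂ + 1) + ((s₁ : ℚ) + 1) / (s₂ + 1) + (2 ^ n)⁻¹ := by
      positivity
    linarith

theorem re_formallyDisjoint {α : ℕ → X}
    (hα : ComputableRealFun fun p : ℕ × ℕ => dist (α p.1) (α p.2)) :
    REPred fun p : ℕ × ℕ => FormallyDisjoint α p.1 p.2 := by
  obtain ⟨F, ⟨a, b, c, ha, hb, hc, hF⟩, hd⟩ := hα
  let e : (ℕ × ℕ) × ℕ → (ℕ × ℕ) × ℕ := fun x => ((x.1.1.unpair.1, x.1.2.unpair.1), x.2)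
  let q : (ℕ × ℕ) × ℕ → Prop := fun x =>
    posRat x.1.1.unpair.2 + posRat x.1.2.unpair.2 + (2 ^ x.2)⁻¹ < F (e x)
  have hq : ComputablePred q := by
    have hpow : Primrec₂ ((· ^ ·) : ℕ → ℕ → ℕ) := Primrec₂.unpaired'.1 Nat.Primrec.pow
    have hu : Computable Nat.unpair := Primrec.unpair.to_comp
    have h1 : Computable fun x : (ℕ × ℕ) × ℕ => x.1.1.unpair :=
      hu.comp (Computable.fst.comp Computable.fst)
    have h2 : Computable fun x : (ℕ × ℕ) × ℕ => x.1.2.unpair :=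
      hu.comp (Computable.snd.comp Computable.fst)
    have he : Computable e :=
      ((Computable.fst.comp h1).pair (Computable.fst.comp h2)).pair Computable.snd
    have hr : Computable fun x : (ℕ × ℕ) × ℕ => x.1.1.unpair.2.unpair :=
      hu.comp (Computable.snd.comp h1)
    have hs : Computable fun x : (ℕ × ℕ) × ℕ => x.1.2.unpair.2.unpair :=
      hu.comp (Computable.snd.comp h2)
    have hmul {f g : (ℕ × ℕ) × ℕ → ℕ} (hf : Computable f) (hg : Computable g) :
        Computable fun x => f x * g x := Primrec.nat_mul.to_comp.comp hf hg
    have hadd {f g : (ℕ × ℕ) × ℕ → ℕ} (hf : Computable f) (hg : Computable g) :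
        Computable fun x => f x + g x := Primrec.nat_add.to_comp.comp hf hg
    have hsucc {f : (ℕ × ℕ) × ℕ → ℕ} (hf : Computable f) :
        Computable fun x => f x + 1 := Computable.succ.comp hf
    have hr₁ := hsucc (Computable.fst.comp hr)
    have hr₂ := hsucc (Computable.snd.comp hr)
    have hs₁ := hsucc (Computable.fst.comp hs)
    have hs₂ := hsucc (Computable.snd.comp hs)
    have h2n : Computable fun x : (ℕ × ℕ) × ℕ => 2 ^ x.2 :=
      hpow.to_comp.comp (Computable.const 2) Computable.snd
    have hl := hmul (hadd (hmul h2n (hadd (hmul hr₁ hs₂) (hmul hs₁ hr₂))) (hmul hr₂ hs₂))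
      (hsucc (hb.comp he))
    have hg := hmul (ha.comp he) (hmul h2n (hmul hr₂ hs₂))
    have hdec : Primrec fun y : ℕ × ℕ × ℕ => decide (y.1 % 2 = 0 ∧ y.2.1 < y.2.2) :=
      PrimrecPred.decide <| PrimrecPred.and
        (PrimrecRel.comp Primrec.eq (Primrec.nat_mod.comp Primrec.fst (Primrec.const 2))
          (Primrec.const 0))
        (PrimrecRel.comp Primrec.nat_lt (Primrec.fst.comp Primrec.snd)
          (Primrec.snd.comp Primrec.snd))
    classical
    refine ⟨fun _ => inferInstance, (hdec.to_comp.comp ((hc.comp he).pair (hl.pair hg))).of_eq ?_⟩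
    intro x
    simp only [q, posRat, hF, lt_signed_frac_iff]
  refine hq.exists_nat.of_eq ?_
  rintro ⟨i, j⟩
  simp only [q, e, FormallyDisjoint]
  have hd' := fun n => hd (i.unpair.1, j.unpair.1) n
  simp only [abs_lt] at hd'
  constructor
  · rintro ⟨n, hn⟩
    have hn' : (posRat i.unpair.2 : ℝ) + posRat j.unpair.2 + (2 ^ n)⁻¹ <
      F ((i.unpair.1, j.unpair.1), n) := by
      rw [← Rat.cast_lt (K := ℝ)] at hn
      push_cast at hn
      exact hn
    linarith [(hd' n).1]
  · intro h
    -- Half of the gap, because `2^(-n)` is spent twice: as the error of `F` and as the margin in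
    -- `q`.
    obtain ⟨n, hn⟩ := exists_pow_lt_of_lt_one
      (half_pos (sub_pos.2 h)) (by norm_num : (1 / 2 : ℝ) < 1)
    rw [one_div, inv_pow] at hn
    refine ⟨n, ?_⟩
    have : (posRat i.unpair.2 : ℝ) + posRat j.unpair.2 + (2 ^ n)⁻¹ <
      F ((i.unpair.1, j.unpair.1), n) := by linarith [(hd' n).2]
    rw [← Rat.cast_lt (K := ℝ)]
    push_cast
    exact this

end FormallyDisjoint

/-! ### Enumerating the finite covers of a co-c.e. compact set. -/

section Cover

variable {X : Type*} [MetricSpace X]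

theorem mem_ratUnion_pair {α : ℕ → X} {i : ℕ} {l : List ℕ} {x : X} :
    x ∈ ratUnion α (Nat.pair i (Encodable.encode l)) ↔
      x ∈ ratBall α i ∨ ∃ k ∈ l, x ∈ ratBall α k := by
  simp [ratUnion, finSeq]

theorem isOpen_ratBall (α : ℕ → X) (i : ℕ) : IsOpen (ratBall α i) := Metric.isOpen_ball

/-- Search for a list of balls from the complement of `S` which, added to the given ones, cover `K`.
Such balls miss `S`, giving soundness; compactness of `K` minus the given balls provides the list
when `S` is covered. -/
theorem re_subset_ratUnion_of_isCoCE {α : ℕ → X} {S K : Set X} (hS : IsCoCE α S)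
    (hK : IsComputablyCompact α K) (hSK : S ⊆ K) :
    REPred fun x : ℕ × List ℕ => S ⊆ ratUnion α (Nat.pair x.1 (Encodable.encode x.2)) := by
  obtain ⟨-, A, hA, hAS⟩ := hS
  obtain ⟨hKc, -, hKre⟩ := hK
  have h1 : REPred fun y : (ℕ × List ℕ) × List ℕ =>
      K ⊆ ratUnion α (Nat.pair y.1.1 (Encodable.encode (y.1.2 ++ y.2))) := by
    refine hKre.comp (f := fun y : (ℕ × List ℕ) × List ℕ =>
      Nat.pair y.1.1 (Encodable.encode (y.1.2 ++ y.2))) (Primrec.to_comp ?_)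
    exact Primrec₂.natPair.comp (Primrec.fst.comp Primrec.fst)
      (Primrec.encode.comp (Primrec.list_append.comp (Primrec.snd.comp Primrec.fst) Primrec.snd))
  have h2 : REPred fun y : (ℕ × List ℕ) × List ℕ => ∀ k ∈ y.2, k ∈ A :=
    (REPred.forall_mem_list (p := fun z : ℕ × Unit => z.1 ∈ A) (hA.comp Computable.fst)).comp
      (f := fun y : (ℕ × List ℕ) × List ℕ => (y.2, ()))
      (Computable.snd.pair (Computable.const ()))
  refine (h2.and h1).exists.of_eq ?_
  rintro ⟨i, l⟩
  simp only
  constructor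
  · rintro ⟨l', hl', hK'⟩ x hx
    have := hK' (hSK hx)
    simp only [mem_ratUnion_pair, List.mem_append] at this ⊢
    rcases this with h | ⟨k, hk | hk, hxk⟩
    · exact Or.inl h
    · exact Or.inr ⟨k, hk, hxk⟩
    · have : x ∈ Sᶜ := by
        rw [hAS]
        exact Set.mem_biUnion (hl' k hk) hxk
      exact absurd hx this
  · intro hSc
    obtain ⟨t, ht⟩ := (hKc.diff
      (isOpen_biUnion fun k (_ : k ∈ finSeq (Nat.pair i (Encodable.encode l))) =>
        isOpen_ratBall α k)).elim_finite_subcover (fun k : A => ratBall α k)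
      (fun k => isOpen_ratBall α k) (by
        rintro x ⟨-, hx⟩
        have : x ∈ Sᶜ := fun hxS => hx (hSc hxS)
        rw [hAS] at this
        simpa using this)
    refine ⟨t.toList.map Subtype.val, ?_, ?_⟩
    · intro k hk
      obtain ⟨k', -, rfl⟩ := List.mem_map.1 hk
      exact k'.2
    · intro x hx
      simp only [mem_ratUnion_pair, List.mem_append]
      by_cases hxl : x ∈ ratUnion α (Nat.pair i (Encodable.encode l))
      · rw [mem_ratUnion_pair] at hxl
        rcases hxl with h | ⟨k, hk, hxk⟩
        · exact Or.inl h
        · exact Or.inr ⟨k, Or.inl hk, hxk⟩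
      · obtain ⟨k, hk, hxk⟩ := Set.mem_iUnion₂.1 (ht ⟨hx, hxl⟩)
        exact Or.inr ⟨k, Or.inr (List.mem_map.2 ⟨k, Finset.mem_toList.2 hk, rfl⟩), hxk⟩

end Cover

/-! ### Fine covers of separated compact sets. -/

section Separation

variable {X : Type*} [MetricSpace X]

theorem exists_ratBall_cover {α : ℕ → X} (hα : DenseRange α) {C : Set X} (hC : IsCompact C)
    {ε : ℝ} (hε : 0 < ε) :
    ∃ l : List ℕ, (∀ x ∈ C, ∃ k ∈ l, x ∈ ratBall α k) ∧
      ∀ k ∈ l, ∃ x ∈ C, dist x (α k.unpair.1) < ε ∧ (posRat k.unpair.2 : ℝ) < ε := by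
  let A : Set ℕ := {k | ∃ x ∈ C, dist x (α k.unpair.1) < ε ∧ (posRat k.unpair.2 : ℝ) < ε}
  obtain ⟨t, ht⟩ := hC.elim_finite_subcover (fun k : A => ratBall α k)
    (fun k => isOpen_ratBall α k) (by
      intro x hx
      obtain ⟨N, hN⟩ := exists_nat_one_div_lt hε
      obtain ⟨c, hc⟩ := hα.exists_dist_lt x (by positivity : (0 : ℝ) < 1 / ((N : ℝ) + 1))
      refine Set.mem_iUnion.2 ⟨⟨Nat.pair c (Nat.pair 0 N), x, hx, ?_, ?_⟩, ?_⟩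
      · simpa using hc.trans hN
      · simpa [posRat] using hN
      · simpa [ratBall, posRat] using hc)
  refine ⟨t.toList.map Subtype.val, fun x hx => ?_, fun k hk => ?_⟩
  · obtain ⟨k, hk, hxk⟩ := Set.mem_iUnion₂.1 (ht hx)
    exact ⟨k, List.mem_map.2 ⟨k, Finset.mem_toList.2 hk, rfl⟩, hxk⟩
  · obtain ⟨k', -, rfl⟩ := List.mem_map.1 hk
    exact k'.2

theorem exists_tagged_ratBall_cover {τ : Type*} [Fintype τ] {α : ℕ → X} (hα : DenseRange α)
    {C : τ → Set X} (hC : ∀ t, IsCompact (C t)) {ε : ℝ} (hε : 0 < ε) :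
    ∃ M : List (τ × ℕ), (∀ t, ∀ x ∈ C t, ∃ k, (t, k) ∈ M ∧ x ∈ ratBall α k) ∧
      ∀ p ∈ M, ∃ x ∈ C p.1, dist x (α p.2.unpair.1) < ε ∧ (posRat p.2.unpair.2 : ℝ) < ε := by
  choose l hl hl' using fun t => exists_ratBall_cover hα (hC t) hε
  refine ⟨Finset.univ.toList.flatMap fun t => (l t).map fun k => (t, k), ?_, ?_⟩
  · intro t x hx
    obtain ⟨k, hk, hxk⟩ := hl t x hx
    exact ⟨k, by simpa using hk, hxk⟩
  · rintro ⟨t, k⟩ hp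
    exact hl' t k (by simpa using hp)

theorem FormallyDisjoint.symm {α : ℕ → X} {i j : ℕ} (h : FormallyDisjoint α i j) :
    FormallyDisjoint α j i := by
  unfold FormallyDisjoint at *
  rwa [add_comm, dist_comm]

theorem formallyDisjoint_of_near {α : ℕ → X} {i j : ℕ} {x y : X} {ε ε' : ℝ}
    (hx : dist x (α i.unpair.1) < ε ∧ (posRat i.unpair.2 : ℝ) < ε)
    (hy : dist y (α j.unpair.1) < ε' ∧ (posRat j.unpair.2 : ℝ) < ε')
    (h : 2 * ε + 2 * ε' ≤ dist x y) : FormallyDisjoint α i j := by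
  unfold FormallyDisjoint
  have := dist_triangle4_right x y (α i.unpair.1) (α j.unpair.1)
  linarith [hx.1, hx.2, hy.1, hy.2]

theorem exists_pos_le_dist {C D : Set X} (hC : IsCompact C) (hD : IsCompact D)
    (h : Disjoint C D) : ∃ η > 0, ∀ x ∈ C, ∀ y ∈ D, η ≤ dist x y := by
  obtain ⟨δ, hδ, hd⟩ := h.exists_thickenings hC hD.isClosed
  refine ⟨δ, hδ, fun x hx y hy => ?_⟩
  by_contra! hlt
  refine hd.le_bot ⟨Metric.mem_thickening_iff.2 ⟨x, hx, ?_⟩, Metric.self_subset_thickening hδ D hy⟩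
  rwa [dist_comm]

theorem exists_pos_forall_le_dist {τ : Type*} [Finite τ] {C D : τ → Set X}
    (hC : ∀ t, IsCompact (C t)) (hD : ∀ t, IsCompact (D t)) (h : ∀ t, Disjoint (C t) (D t)) :
    ∃ η > 0, ∀ t, ∀ x ∈ C t, ∀ y ∈ D t, η ≤ dist x y := by
  choose η hη hle using fun t => exists_pos_le_dist (hC t) (hD t) (h t)
  have hev : ∀ᶠ e in nhdsWithin (0 : ℝ) (Set.Ioi 0), ∀ t, e ≤ η t :=
    Filter.eventually_all.2 fun t => nhdsWithin_le_nhds ((eventually_lt_nhds (hη t)).mono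
      fun _ h => h.le)
  obtain ⟨e, he, he0⟩ := (hev.and self_mem_nhdsWithin).exists
  exact ⟨e, he0, fun t x hx y hy => (he t).trans (hle t x hx y hy)⟩

end Separation

/-! ### Local certificates that a rational ball meets the set. -/

section Certificate

variable {X : Type*} [MetricSpace X] {m : ℕ}

/-- In a list of rational balls, each tagged by an axis and a direction, balls with opposite tags
are formally disjoint. -/
def TagSeparated (α : ℕ → X) (M : List ((Fin m × Bool) × ℕ)) : Prop :=
  ∀ x ∈ M, ∀ y ∈ M, x.1.1 = y.1.1 ∧ x.1.2 ≠ y.1.2 → FormallyDisjoint α x.2 y.2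

/-- A certificate that the `i`-th rational ball meets `S`: together with the balls in `W`, it fills
up what a tag separated family extending `O` leaves uncovered. -/
def IsCertified (α : ℕ → X) (S : Set X) (W : List ℕ) (O : List ((Fin m × Bool) × ℕ))
    (i : ℕ) : Prop :=
  ∃ M : List ((Fin m × Bool) × ℕ), TagSeparated α (M ++ O) ∧
    S ⊆ ratUnion α (Nat.pair i (Encodable.encode (W ++ (M ++ O).map Prod.snd)))

theorem re_tagSeparated {α : ℕ → X}
    (hα : ComputableRealFun fun p : ℕ × ℕ => dist (α p.1) (α p.2)) :
    REPred fun M : List ((Fin m × Bool) × ℕ) => TagSeparated α M := by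
  let T := (Fin m × Bool) × ℕ
  let opp : (Fin m × Bool) × (Fin m × Bool) → Bool := fun s =>
    decide (s.1.1 = s.2.1 ∧ s.1.2 ≠ s.2.2)
  have hopp : REPred fun p : T × T => ¬ (p.1.1.1 = p.2.1.1 ∧ p.1.1.2 ≠ p.2.1.2) := by
    refine ComputablePred.to_re (ComputablePred.computable_iff.2
      ⟨fun p => !opp (p.1.1, p.2.1), Primrec.to_comp ?_, ?_⟩)
    · exact Primrec.not.comp ((Primrec.dom_finite opp).comp
        ((Primrec.fst.comp Primrec.fst).pair (Primrec.fst.comp Primrec.snd)))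
    · funext p
      simp only [opp, Bool.not_eq_true', decide_eq_false_iff_not]
  have hfd : REPred fun p : T × T => FormallyDisjoint α p.1.2 p.2.2 :=
    (re_formallyDisjoint hα).comp (f := fun p : T × T => (p.1.2, p.2.2))
      ((Computable.snd.comp Computable.fst).pair (Computable.snd.comp Computable.snd))
  have h1 : REPred fun p : T × T =>
      p.2.1.1 = p.1.1.1 ∧ p.2.1.2 ≠ p.1.1.2 → FormallyDisjoint α p.2.2 p.1.2 :=
    ((hopp.or hfd).comp (f := fun p : T × T => (p.2, p.1))
      (Computable.snd.pair Computable.fst)).of_eq fun p => imp_iff_not_or.symm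
  have h2 := h1.forall_mem_list.comp (f := fun p : T × List T => (p.2, p.1))
    (Computable.snd.pair Computable.fst)
  exact h2.forall_mem_list.comp (f := fun M : List T => (M, M)) (Computable.id.pair Computable.id)

theorem re_isCertified {α : ℕ → X} {S : Set X}
    (hα : ComputableRealFun fun p : ℕ × ℕ => dist (α p.1) (α p.2))
    (hS : REPred fun x : ℕ × List ℕ => S ⊆ ratUnion α (Nat.pair x.1 (Encodable.encode x.2)))
    (W : List ℕ) (O : List ((Fin m × Bool) × ℕ)) : REPred (IsCertified α S W O) := by
  let T := (Fin m × Bool) × ℕ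
  have happ : Primrec fun p : ℕ × List T => p.2 ++ O :=
    Primrec.list_append.comp Primrec.snd (Primrec.const O)
  have h1 := (re_tagSeparated (m := m) hα).comp happ.to_comp
  have h2 := hS.comp (f := fun p : ℕ × List T => (p.1, W ++ (p.2 ++ O).map Prod.snd))
    (Primrec.to_comp (Primrec.fst.pair (Primrec.list_append.comp (Primrec.const W)
      (Primrec.list_map happ (Primrec.snd.comp Primrec.snd)))))
  exact (h1.and h2).exists

/-- The orientation of a face of the cube. -/
def faceSign (b : Bool) : ℝ := if b then 1 else -1

/-- Pull the tagged balls back to the cube: opposite families are disjoint open sets containing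
opposite faces, so Poincaré–Miranda yields a point outside all of them. Its image also avoids `W`,
hence lies in the remaining ball of the cover. -/
theorem IsCertified.nonempty {α : ℕ → X} {S : Set X} {W : List ℕ}
    {O : List ((Fin m × Bool) × ℕ)} {i : ℕ} (h : IsCertified α S W O i)
    {φ : (Fin m → ℝ) → X} (hφ : Continuous φ) (hφS : ∀ y, φ y ∈ S)
    (hW : ∀ k ∈ W, ∀ y ∈ Metric.closedBall (0 : Fin m → ℝ) 1, φ y ∉ ratBall α k)
    (hO : ∀ t : Fin m × Bool, ∀ y ∈ Metric.closedBall (0 : Fin m → ℝ) 1,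
      faceSign t.2 * y t.1 = 1 → ∃ k, (t, k) ∈ O ∧ φ y ∈ ratBall α k) :
    (S ∩ ratBall α i).Nonempty := by
  obtain ⟨M, hM, hcov⟩ := h
  let U : Bool → Fin m → Set (Fin m → ℝ) := fun b j =>
    {y | ∃ k, ((j, b), k) ∈ M ++ O ∧ φ y ∈ ratBall α k}
  have hUo : ∀ b j, IsOpen (U b j) := by
    intro b j
    have : U b j = ⋃ k, ⋃ _ : ((j, b), k) ∈ M ++ O, φ ⁻¹' ratBall α k := by
      ext y
      simp [U]
    rw [this]
    exact isOpen_iUnion fun k => isOpen_iUnion fun _ => (isOpen_ratBall α k).preimage hφ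
  have hcube : Set.Icc (-1 : Fin m → ℝ) 1 = Metric.closedBall (0 : Fin m → ℝ) 1 := by
    ext y
    simp [pi_norm_le_iff_of_nonneg, Pi.le_def, abs_le, forall_and]
  have hface : ∀ t : Fin m × Bool, ∀ y ∈ Set.Icc (-1 : Fin m → ℝ) 1,
      faceSign t.2 * y t.1 = 1 → y ∈ U t.2 t.1 := by
    intro t y hy hyt
    obtain ⟨k, hk, hyk⟩ := hO t y (hcube ▸ hy) hyt
    exact ⟨k, List.mem_append_right _ hk, hyk⟩
  obtain ⟨y, hy, hyU⟩ := exists_mem_cube_notMem (U true) (U false) (hUo true) (hUo false)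
    (by
      intro j
      rw [Set.disjoint_left]
      rintro y ⟨k, hk, hyk⟩ ⟨k', hk', hyk'⟩
      exact (hM _ hk _ hk' ⟨rfl, by simp⟩).disjoint.le_bot ⟨hyk, hyk'⟩)
    (fun j y hy hyj => hface (j, true) y hy (by simp [faceSign, hyj]))
    (fun j y hy hyj => hface (j, false) y hy (by simp [faceSign, hyj]))
  refine ⟨φ y, hφS y, ?_⟩
  rcases mem_ratUnion_pair.1 (hcov (hφS y)) with h | ⟨k, hk, hyk⟩
  · exact h
  · exfalso
    rcases List.mem_append.1 hk with hk | hk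
    · exact hW k hk y (hcube ▸ hy) hyk
    · obtain ⟨⟨⟨j, b⟩, k'⟩, hp, rfl⟩ := List.mem_map.1 hk
      cases b with
      | true => exact (hyU j).1 ⟨k', hp, hyk⟩
      | false => exact (hyU j).2 ⟨k', hp, hyk⟩

theorem eq_faceSign_neg {b b' : Bool} (h : b ≠ b') : faceSign b' = - faceSign b := by
  cases b <;> cases b' <;> simp_all [faceSign]

theorem abs_faceSign_mul (b : Bool) (x : ℝ) : |faceSign b * x| = |x| := by
  cases b <;> simp [faceSign]

theorem exists_re_local_certificate {α : ℕ → X} (hX : IsComputableMetricSpace α) {S : Set X}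
    (hSc : IsCompact S)
    (hS : REPred fun x : ℕ × List ℕ => S ⊆ ratUnion α (Nat.pair x.1 (Encodable.encode x.2)))
    {ψ : (Fin m → ℝ) → S} (hψ : Topology.IsOpenEmbedding ψ) :
    ∃ p : ℕ → Prop, REPred p ∧ (∀ i, p i → (S ∩ ratBall α i).Nonempty) ∧
      ∀ i, ∀ c ∈ Metric.ball (0 : Fin m → ℝ) (1 / 2), (ψ c : X) ∈ ratBall α i → p i := by
  let φ : (Fin m → ℝ) → X := fun y => ψ y
  have hφ : Continuous φ := continuous_subtype_val.comp hψ.continuous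
  have hφi : Function.Injective φ := Subtype.val_injective.comp hψ.injective
  have hφS : ∀ y, φ y ∈ S := fun y => (ψ y).2
  -- the part of `S` outside the larger cube
  let R : Set X := Subtype.val '' (ψ '' Metric.ball 0 2)ᶜ
  have hR : IsCompact R := by
    have : CompactSpace S := isCompact_iff_compactSpace.1 hSc
    exact (hψ.isOpenMap _ Metric.isOpen_ball).isClosed_compl.isCompact.image
      continuous_subtype_val
  have hRQ : Disjoint R (φ '' Metric.closedBall 0 1) := by
    rw [Set.disjoint_left]
    rintro _ ⟨s, hs, rfl⟩ ⟨y, hy, hys⟩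
    exact hs ⟨y, Metric.closedBall_subset_ball (by norm_num) hy, Subtype.ext hys⟩
  obtain ⟨ηR, hηR, hRdist⟩ :=
    exists_pos_le_dist hR ((isCompact_closedBall _ _).image hφ) hRQ
  -- With centres within `ηR / 2` of `R` and radii below `ηR / 2`, these balls cannot reach the
  -- image of the unit cube.
  obtain ⟨W, hWcov, hWnear⟩ := exists_ratBall_cover hX.dense hR (half_pos hηR)
  -- the faces of the smaller cube
  let E : Fin m × Bool → Set X := fun t =>
    φ '' (Metric.closedBall 0 2 ∩ {y | -(1 / 2) ≤ faceSign t.2 * y t.1})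
  let F : Fin m × Bool → Set X := fun t =>
    φ '' (Metric.closedBall 0 1 ∩ {y | faceSign t.2 * y t.1 = 1})
  have hcoord : ∀ t : Fin m × Bool, Continuous fun y : Fin m → ℝ => faceSign t.2 * y t.1 :=
    fun t => continuous_const.mul (continuous_apply _)
  have hE : ∀ t, IsCompact (E t) := fun t =>
    ((isCompact_closedBall _ _).inter_right
      (isClosed_le continuous_const (hcoord t))).image hφ
  have hF : ∀ t, IsCompact (F t) := fun t =>
    ((isCompact_closedBall _ _).inter_right
      (isClosed_eq (hcoord t) continuous_const)).image hφ
  have hFE : ∀ t, F t ⊆ E t := by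
    rintro t _ ⟨y, ⟨hy, hyt⟩, rfl⟩
    refine ⟨y, ⟨Metric.closedBall_subset_closedBall (by norm_num) hy, ?_⟩, rfl⟩
    rw [Set.mem_ofPred_eq] at hyt ⊢
    rw [hyt]
    norm_num
  have hEF : ∀ t : Fin m × Bool, Disjoint (E t) (F (t.1, !t.2)) := by
    intro t
    rw [Set.disjoint_left]
    rintro _ ⟨y, ⟨-, hy⟩, rfl⟩ ⟨z, ⟨-, hz⟩, hzy⟩
    obtain rfl := hφi hzy
    simp only [Set.mem_ofPred_eq] at hy hz
    rw [eq_faceSign_neg (b := t.2) (by simp)] at hz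
    linarith
  obtain ⟨η₀, hη₀, hdist₀⟩ := exists_pos_forall_le_dist hE (fun t => hF (t.1, !t.2)) hEF
  obtain ⟨O, hOcov, hOnear⟩ :=
    exists_tagged_ratBall_cover hX.dense hF (by positivity : 0 < η₀ / 4)
  refine ⟨IsCertified α S W O, re_isCertified hX.computable_dist hS W O, fun i hi => ?_, ?_⟩
  · refine hi.nonempty hφ hφS ?_ ?_
    · intro k hk y hy hyk
      obtain ⟨x, hx, hxk, hrk⟩ := hWnear k hk
      have h1 := hRdist x hx _ ⟨y, hy, rfl⟩
      have h2 : dist (φ y) (α k.unpair.1) < posRat k.unpair.2 := hyk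
      linarith [dist_triangle_right x (φ y) (α k.unpair.1)]
    · intro t y hy hyt
      exact hOcov t _ ⟨y, ⟨hy, hyt⟩, rfl⟩
  · intro i c hc hci
    obtain ⟨δ, hδ, hδi⟩ := Metric.isOpen_iff.1 ((isOpen_ratBall α i).preimage hφ) c hci
    -- The slabs of the cube of radius 2 lying at least `δ` beyond `c` in each signed axis
    -- direction; with the `δ`-cube around `c` they fill that cube.
    let C : Fin m × Bool → Set X := fun t =>
      φ '' (Metric.closedBall 0 2 ∩ {y | δ + faceSign t.2 * c t.1 ≤ faceSign t.2 * y t.1})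
    have hC : ∀ t, IsCompact (C t) := fun t =>
      ((isCompact_closedBall _ _).inter_right
        (isClosed_le continuous_const (hcoord t))).image hφ
    have hCE : ∀ t, C t ⊆ E t := by
      rintro t _ ⟨y, ⟨hy, hyt⟩, rfl⟩
      refine ⟨y, ⟨hy, ?_⟩, rfl⟩
      rw [Set.mem_ofPred_eq] at hyt ⊢
      have h1 : |faceSign t.2 * c t.1| ≤ 1 / 2 := by
        rw [abs_faceSign_mul]
        exact (norm_le_pi_norm c t.1).trans (mem_ball_zero_iff.1 hc).le
      linarith [neg_le_of_abs_le h1]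
    have hCC : ∀ t : Fin m × Bool, Disjoint (C t) (C (t.1, !t.2)) := by
      intro t
      rw [Set.disjoint_left]
      rintro _ ⟨y, ⟨-, hy⟩, rfl⟩ ⟨z, ⟨-, hz⟩, hzy⟩
      obtain rfl := hφi hzy
      simp only [Set.mem_ofPred_eq] at hy hz
      rw [eq_faceSign_neg (b := t.2) (by simp)] at hz
      linarith
    obtain ⟨η, hη, hdist⟩ := exists_pos_forall_le_dist hC (fun t => hC (t.1, !t.2)) hCC
    obtain ⟨M, hMcov, hMnear⟩ :=
      -- The bound by `η` separates balls of `M` from each other, the bound by `η₀` separates them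
      -- from those of `O`.
      exists_tagged_ratBall_cover hX.dense hC (by positivity : 0 < min η η₀ / 4)
    have hmin : min η η₀ ≤ η := min_le_left _ _
    have hmin₀ : min η η₀ ≤ η₀ := min_le_right _ _
    have htag : ∀ s t : Fin m × Bool, s.1 = t.1 ∧ s.2 ≠ t.2 → t = (s.1, !s.2) := by
      rintro ⟨a, b⟩ ⟨a', b'⟩ ⟨h1, h2⟩
      cases b <;> cases b' <;> simp_all
    refine ⟨M, ?_, ?_⟩
    · intro x hx y hy hxy
      rcases List.mem_append.1 hx with hx | hx <;> rcases List.mem_append.1 hy with hy | hy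
      · obtain ⟨u, hu, hux⟩ := hMnear x hx
        obtain ⟨v, hv, hvy⟩ := hMnear y hy
        rw [htag _ _ hxy] at hv
        exact formallyDisjoint_of_near hux hvy (by linarith [hdist _ u hu v hv])
      · obtain ⟨u, hu, hux⟩ := hMnear x hx
        obtain ⟨v, hv, hvy⟩ := hOnear y hy
        rw [htag _ _ hxy] at hv
        exact formallyDisjoint_of_near hux hvy (by linarith [hdist₀ _ u (hCE _ hu) v hv])
      · obtain ⟨u, hu, hux⟩ := hOnear x hx
        obtain ⟨v, hv, hvy⟩ := hMnear y hy
        rw [htag _ _ ⟨hxy.1.symm, hxy.2.symm⟩] at hu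
        exact (formallyDisjoint_of_near hvy hux
          (by linarith [hdist₀ _ v (hCE _ hv) u hu])).symm
      · obtain ⟨u, hu, hux⟩ := hOnear x hx
        obtain ⟨v, hv, hvy⟩ := hOnear y hy
        rw [htag _ _ hxy] at hv
        exact formallyDisjoint_of_near hux hvy (by linarith [hdist₀ _ u (hFE _ hu) v hv])
    · intro s hs
      simp only [mem_ratUnion_pair, List.mem_append, List.mem_map]
      by_cases hsR : s ∈ R
      · obtain ⟨k, hk, hsk⟩ := hWcov s hsR
        exact Or.inr ⟨k, Or.inl hk, hsk⟩
      · have hsψ : (⟨s, hs⟩ : S) ∈ ψ '' Metric.ball 0 2 := by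
          by_contra hn
          exact hsR ⟨⟨s, hs⟩, hn, rfl⟩
        obtain ⟨y, hy, hys⟩ := hsψ
        have hys' : φ y = s := congrArg Subtype.val hys
        by_cases hyc : y ∈ Metric.ball c δ
        · exact Or.inl (hys' ▸ hδi hyc)
        · have hnot : ¬ ∀ j, dist (y j) (c j) < δ := fun h => hyc ((dist_pi_lt_iff hδ).2 h)
          push Not at hnot
          obtain ⟨j, hj⟩ := hnot
          have hb : ∃ b, s ∈ C (j, b) := by
            have hy2 := Metric.ball_subset_closedBall hy
            rw [Real.dist_eq, le_abs] at hj
            rcases hj with hj | hj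
            · exact ⟨true, y, ⟨hy2, by simp only [faceSign, Set.mem_ofPred_eq]; grind⟩, hys'⟩
            · exact ⟨false, y, ⟨hy2, by simp only [faceSign, Set.mem_ofPred_eq]; grind⟩, hys'⟩
          obtain ⟨b, hb⟩ := hb
          obtain ⟨k, hk, hsk⟩ := hMcov _ s hb
          exact Or.inr ⟨k, Or.inr ⟨_, Or.inl hk, rfl⟩, hsk⟩

end Certificate

/-- Every point of a topological sphere is the centre of a Euclidean chart. -/
theorem IsTopSphere.exists_isOpenEmbedding {X : Type*} [MetricSpace X] {m : ℕ} {S : Set X}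
    (hS : IsTopSphere m S) (p : S) :
    ∃ ψ : (Fin m → ℝ) → S, Topology.IsOpenEmbedding ψ ∧ ψ 0 = p := by
  obtain ⟨h⟩ := hS
  have : Fact (Module.finrank ℝ (EuclideanSpace ℝ (Fin (m + 1))) = m + 1) := ⟨by simp⟩
  set v := h.symm p with hv
  -- Projecting from the antipode keeps `v` in the domain; the translation `a` then moves its image
  -- to the origin.
  let e := stereographic' m (-v)
  have hve : v ∈ e.source := by
    rw [stereographic'_source]
    exact ne_neg_of_mem_unit_sphere ℝ v
  have he : Topology.IsOpenEmbedding e.symm :=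
    e.symm.isOpenEmbedding (by simp [e])
  let a : (Fin m → ℝ) ≃ₜ EuclideanSpace ℝ (Fin m) :=
    (EuclideanSpace.equiv (Fin m) ℝ).symm.toHomeomorph.trans (Homeomorph.addRight (e v))
  refine ⟨h ∘ e.symm ∘ a, h.isOpenEmbedding.comp (he.comp a.isOpenEmbedding), ?_⟩
  have ha : a 0 = e v := by simp [a]
  rw [Function.comp_apply, Function.comp_apply, ha, e.left_inv hve, hv, h.apply_symm_apply]

theorem IsTopSphere.isCompact {X : Type*} [MetricSpace X] {m : ℕ} {S : Set X}
    (hS : IsTopSphere m S) : IsCompact S := by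
  obtain ⟨h⟩ := hS
  have : CompactSpace S := h.compactSpace
  exact isCompact_iff_compactSpace.2 this

end CompMetric

theorem theorem4p8 {X : Type*} [MetricSpace X] (α : ℕ → X)
    (hX : CompMetric.IsComputableMetricSpace α)
    (hloc : CompMetric.IsLocallyComputable α)
    (n : ℕ) (hn : 1 ≤ n) (S : Set X)
    (hS : CompMetric.IsTopSphere (n - 1) S)
    (hco : CompMetric.IsCoCE α S) :
    CompMetric.IsComputableSet α S := by
  refine ⟨⟨hco.1, ?_⟩, hco⟩
  obtain ⟨K, hK, hSK⟩ := hloc S hS.isCompact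
  have hcov := CompMetric.re_subset_ratUnion_of_isCoCE hco hK hSK
  choose ψ hψ hψ0 using hS.exists_isOpenEmbedding
  choose p hp hsound hcomplete using fun x =>
    CompMetric.exists_re_local_certificate hX hS.isCompact hcov (hψ x)
  have : CompactSpace S := isCompact_iff_compactSpace.1 hS.isCompact
  -- Completeness of a local certificate holds only on the half-size cube of its chart, so these are
  -- the sets that must cover `S`.
  obtain ⟨t, -, ht⟩ := isCompact_univ.elim_nhds_subcover
    (fun x : S => ψ x '' Metric.ball 0 (1 / 2)) (fun x _ =>
      ((hψ x).isOpenMap _ Metric.isOpen_ball).mem_nhds ⟨0, by simp, hψ0 x⟩)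
  refine (REPred.exists_mem_finset t hp).of_eq fun i => ⟨?_, ?_⟩
  · rintro ⟨x, -, hx⟩
    exact hsound x i hx
  · rintro ⟨s, hs, hsi⟩
    obtain ⟨x, hx, c, hc, hcs⟩ := Set.mem_iUnion₂.1 (ht (Set.mem_univ ⟨s, hs⟩))
    exact ⟨x, hx, hcomplete x i c hc (by rwa [hcs])⟩
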